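/- A left-invariant circular order on a group $G$ is a map $\phi : G^3 \to \{-1,0,1\}$ such that (i) $\phi(x,y,z)=0$ if and only if two of $x,y,z$ are equal; (ii) $\phi(g_1,g_2,g_3)-\phi(g_0,g_2,g_3)+\phi(g_0,g_1,g_3)-\phi(g_0,g_1,g_2)=0$ for all $g_0,g_1,g_2,g_3\in G$; (iii) $\phi(gx,gy,gz)=\phi(x,y,z)$ for all $g,x,y,z\in G$. Every left-invariant linear order $<$ on $G$ gives a left-invariant circular order $c_<$: $c_<(x,y,z)=1$ if $x<y<z$, $y<z<x$ or $z<x<y$; $c_<(x,y,z)=-1$ if $x<z<y$, $z<y<x$ or $y<x<z$; and $c_<(x,y,z)=0$ otherwise. A left-invariant circular order is called genuine if it is not of the form $c_<$, and $\mathrm{CO}_g(G)$ denotes the space of genuine left-invariant circular orders on $G$. The group $\mathrm{Aut}(G)$ acts on $\mathrm{CO}_g(G)$ by $(\rho\cdot\phi)(x,y,z)=\phi(\rho^{-1}(x),\rho^{-1}(y),\rho^{-1}(z))$. Corollary. Let $A$ be a finitely generated abelian group that admits a left-invariant circular order. Then the action of $\mathrm{Aut}(A)$ on $\mathrm{CO}_g(A)$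 is faithful: if $\rho,\sigma\in\mathrm{Aut}(A)$ satisfy $\rho\cdot\phi=\sigma\cdot\phi$ for every $\phi\in\mathrm{CO}_g(A)$, then $\rho=\sigma$. -/

import Mathlib

/-- A left-invariant circular order on a group `G`: a map `φ : G³ → {-1, 0, 1}` which vanishes
exactly on the triples with a repeated entry, satisfies the `2`-cocycle identity, and is
homogeneous under left multiplication. -/
@[ext]
structure LeftCircularOrder (G : Type*) [Group G] where
  toFun : G → G → G → SignType
  eq_zero_iff' : ∀ x y z, toFun x y z = 0 ↔ x = y ∨ y = z ∨ x = z
  cocycle' : ∀ g₀ g₁ g₂ g₃ : G,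
    (toFun g₁ g₂ g₃ : ℤ) - (toFun g₀ g₂ g₃ : ℤ) + (toFun g₀ g₁ g₃ : ℤ)
      - (toFun g₀ g₁ g₂ : ℤ) = 0
  left_inv' : ∀ g g₀ g₁ g₂, toFun (g * g₀) (g * g₁) (g * g₂) = toFun g₀ g₁ g₂

/-- A left-invariant (strict) linear order on a group `G`. -/
@[ext]
structure LeftLinearOrder (G : Type*) [Group G] where
  lt : G → G → Prop
  irrefl' : ∀ x, ¬ lt x x
  trans' : ∀ x y z, lt x y → lt y z → lt x z
  total' : ∀ x y, lt x y ∨ x = y ∨ lt y x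
  left_inv' : ∀ g x y, lt (g * x) (g * y) ↔ lt x y

namespace LeftLinearOrder

variable {G : Type*} [Group G]

open Classical in
/-- The function `c_<` on triples attached to a linear order `<`. -/
noncomputable def cyc (l : LeftLinearOrder G) (x y z : G) : SignType :=
  if (l.lt x y ∧ l.lt y z) ∨ (l.lt y z ∧ l.lt z x) ∨ (l.lt z x ∧ l.lt x y) then 1
  else if (l.lt x z ∧ l.lt z y) ∨ (l.lt z y ∧ l.lt y x) ∨ (l.lt y x ∧ l.lt x z) then -1
  else 0

/-- `c_<` is the coboundary of the sign of comparison. -/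
theorem cyc_cast (l : LeftLinearOrder G) (s : G → G → ℤ)
    (h1 : ∀ x y, l.lt x y → s x y = 1) (h2 : ∀ x y, l.lt y x → s x y = -1)
    (h3 : ∀ x, s x x = 0) (x y z : G) :
    (l.cyc x y z : ℤ) = s x y + s y z - s x z := by
  have a := l.irrefl'
  have b := l.trans'
  unfold cyc
  rcases l.total' x y with h | h | h <;> rcases l.total' y z with h' | h' | h' <;>
    rcases l.total' x z with h'' | h'' | h'' <;> split_ifs <;>
    simp only [SignType.coe_one, SignType.coe_neg_one, SignType.coe_zero] <;> grind

/-- The circular order `c_<` defined by a linear order `<`. -/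
noncomputable def toCircular (l : LeftLinearOrder G) : LeftCircularOrder G where
  toFun := l.cyc
  eq_zero_iff' x y z := by
    have a := l.irrefl'
    have b := l.trans'
    have t1 := l.total' x y
    have t2 := l.total' y z
    have t3 := l.total' x z
    unfold cyc
    split_ifs <;> simp <;> grind
  cocycle' g₀ g₁ g₂ g₃ := by
    classical
    have a := l.irrefl'
    have b := l.trans'
    have key := l.cyc_cast (fun x y => if l.lt x y then 1 else if l.lt y x then -1 else 0)
      (by grind) (by grind) (by grind)
    rw [key, key, key, key]
    ring
  left_inv' g x y z := by
    have h := l.left_inv' g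
    unfold cyc
    split_ifs <;> grind

end LeftLinearOrder

namespace LeftCircularOrder

variable {G : Type*} [Group G]

/-- The left action of `Aut(G)` on the set of circular orders:
`(ρ • φ)(x, y, z) = φ(ρ⁻¹ x, ρ⁻¹ y, ρ⁻¹ z)`. -/
instance : MulAction (MulAut G) (LeftCircularOrder G) where
  smul ρ φ :=
    { toFun := fun x y z => φ.toFun (ρ⁻¹ x) (ρ⁻¹ y) (ρ⁻¹ z)
      eq_zero_iff' := fun x y z => by simp [φ.eq_zero_iff']
      cocycle' := fun _ _ _ _ => φ.cocycle' _ _ _ _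
      left_inv' := fun g x y z => by simp only [map_mul, φ.left_inv'] }
  one_smul _ := rfl
  mul_smul ρ σ φ := by
    apply LeftCircularOrder.ext
    funext x y z
    change φ.toFun ((ρ * σ)⁻¹ x) ((ρ * σ)⁻¹ y) ((ρ * σ)⁻¹ z) = _
    rw [mul_inv_rev]
    rfl

theorem smul_toFun (ρ : MulAut G) (φ : LeftCircularOrder G) (x y z : G) :
    (ρ • φ).toFun x y z = φ.toFun (ρ⁻¹ x) (ρ⁻¹ y) (ρ⁻¹ z) := rfl

/-- Automorphisms carry circular orders coming from linear orders to such orders. -/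
theorem smul_mem_range (ρ : MulAut G) {φ : LeftCircularOrder G}
    (h : φ ∈ Set.range (LeftLinearOrder.toCircular (G := G))) :
    ρ • φ ∈ Set.range (LeftLinearOrder.toCircular (G := G)) := by
  obtain ⟨l, rfl⟩ := h
  exact ⟨{ lt := fun x y => l.lt (ρ⁻¹ x) (ρ⁻¹ y)
           irrefl' := fun x => l.irrefl' _
           trans' := fun x y z => l.trans' _ _ _
           total' := fun x y => by simpa using l.total' (ρ⁻¹ x) (ρ⁻¹ y)
           left_inv' := fun g x y => by simp only [map_mul, l.left_inv'] }, rfl⟩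

/-- `CO_g(G)`: the genuine circular orders, i.e. those that do not come from a left-invariant
linear order, together with the action of `Aut(G)` restricted from all circular orders. -/
def genuine (G : Type*) [Group G] : SubMulAction (MulAut G) (LeftCircularOrder G) where
  carrier := (Set.range (LeftLinearOrder.toCircular (G := G)))ᶜ
  smul_mem' ρ φ h h' := h (by simpa using smul_mem_range ρ⁻¹ h')

end LeftCircularOrder

/-! A single genuine order already separates automorphisms. An injection `e` of A into the circle
pulls back the cyclic orientation to a circular order, genuine if A is nontrivial, which determines
`e` through rotation numbers (`angle_eq_of_toCircular_eq`). Its translate by ρ is the order of e ∘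
ρ⁻¹, so equal translates give e ∘ ρ⁻¹ = e ∘ σ⁻¹, and ρ = σ by injectivity. Such an `e` exists
because any circular order on A restricts to the finite torsion part, which is then cyclic
(`isCyclic_of_finite`); hence A ≅ ℤⁿ × ℤ/N, which embeds by rationally independent irrational
rotations together with the rotation by 1/N. -/

/-- The angle function, with values in `[0, 1)`, of an injective homomorphism from `G` to the
circle group `ℝ ⧸ ℤ`. -/
structure CircleEmbedding (G : Type*) [Group G] where
  angle : G → ℝ
  angle_nonneg : ∀ x, 0 ≤ angle x
  angle_lt_one : ∀ x, angle x < 1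
  angle_mul : ∀ x y, angle (x * y) = angle x + angle y ∨ angle (x * y) = angle x + angle y - 1
  angle_eq_zero : ∀ x, angle x = 0 ↔ x = 1

/-! ### Circle embeddings and their circular orders -/

namespace CircleEmbedding

variable {G H : Type*} [Group G] [Group H]

/-- An embedding into the circle from a real-valued lift. -/
noncomputable def ofLift (r : G → ℝ) (hmul : ∀ x y, ∃ k : ℤ, r (x * y) = r x + r y + k)
    (hinj : ∀ x, (∃ k : ℤ, r x = k) → x = 1) : CircleEmbedding G where
  angle x := Int.fract (r x)
  angle_nonneg x := Int.fract_nonneg _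
  angle_lt_one x := Int.fract_lt_one _
  angle_mul x y := by
    obtain ⟨k, hk⟩ := hmul x y
    rw [hk, Int.fract_add_intCast]
    obtain ⟨m, hm⟩ := Int.fract_add (r x) (r y)
    have h1 := Int.fract_nonneg (r x)
    have h2 := Int.fract_lt_one (r x)
    have h3 := Int.fract_nonneg (r y)
    have h4 := Int.fract_lt_one (r y)
    have h5 := Int.fract_nonneg (r x + r y)
    have h6 := Int.fract_lt_one (r x + r y)
    have h7 : (m : ℝ) < 1 := by linarith
    have h8 : (-2 : ℝ) < m := by linarith
    have h7' : m < 1 := by exact_mod_cast h7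
    have h8' : -2 < m := by exact_mod_cast h8
    obtain rfl | rfl : m = 0 ∨ m = -1 := by omega
    · left; push_cast at hm; linarith
    · right; push_cast at hm; linarith
  angle_eq_zero x := by
    rw [Int.fract_eq_zero_iff]
    constructor
    · rintro ⟨k, hk⟩
      exact hinj x ⟨k, hk.symm⟩
    · rintro rfl
      obtain ⟨k, hk⟩ := hmul 1 1
      rw [mul_one] at hk
      exact ⟨-k, by push_cast; linarith⟩

/-- Restriction of a circle embedding along an injective homomorphism. -/
def comap (e : CircleEmbedding H) (f : G →* H) (hf : Function.Injective f) :
    CircleEmbedding G where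
  angle x := e.angle (f x)
  angle_nonneg x := e.angle_nonneg _
  angle_lt_one x := e.angle_lt_one _
  angle_mul x y := by rw [map_mul]; exact e.angle_mul _ _
  angle_eq_zero x := by rw [e.angle_eq_zero, map_eq_one_iff f hf]

variable (e : CircleEmbedding G)

theorem angle_one : e.angle 1 = 0 := (e.angle_eq_zero 1).2 rfl

open Classical in
/-- The sawtooth function of the angle. -/
noncomputable def saw (x : G) : ℝ := if x = 1 then 0 else e.angle x - 1 / 2

theorem saw_one : e.saw 1 = 0 := if_pos rfl

theorem saw_of_ne {x : G} (h : x ≠ 1) : e.saw x = e.angle x - 1 / 2 := if_neg h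

/-- For `x ≠ 1` the angles of `x` and `x⁻¹` add up to 1, so centring at 1/2 makes the function odd.
-/
theorem saw_inv (x : G) : e.saw x⁻¹ = -e.saw x := by
  by_cases h : x = 1
  · simp [h, saw_one]
  · rw [e.saw_of_ne h, e.saw_of_ne (inv_ne_one.2 h)]
    have h1 := e.angle_mul x x⁻¹
    have h2 := mt (e.angle_eq_zero x).1 h
    have h3 := e.angle_nonneg x
    have h4 := e.angle_nonneg x⁻¹
    rw [mul_inv_cancel, e.angle_one] at h1
    rcases h1 with h1 | h1
    · exact absurd (by linarith) h2
    · linarith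

/-- The orientation of the triple `(1, u, u * v)`, as a real number. -/
noncomputable def turn (u v : G) : ℝ := 2 * (e.saw (u * v) - e.saw u - e.saw v)

theorem turn_eq_zero {u v : G} (h : u = 1 ∨ v = 1 ∨ u * v = 1) : e.turn u v = 0 := by
  unfold turn
  rcases h with rfl | rfl | h
  · simp [saw_one]
  · simp [saw_one]
  · rw [h, eq_inv_of_mul_eq_one_right h, saw_inv, saw_one]; ring

theorem turn_of_ne {u v : G} (hu : u ≠ 1) (hv : v ≠ 1) (huv : u * v ≠ 1) :
    e.turn u v = 2 * (e.angle (u * v) - e.angle u - e.angle v) + 1 := by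
  rw [turn, e.saw_of_ne hu, e.saw_of_ne hv, e.saw_of_ne huv]; ring

/-- The value is 1 when the angles add without wrapping around the circle, and -1 when they wrap. -/
theorem turn_eq_one_or_neg_one {u v : G} (hu : u ≠ 1) (hv : v ≠ 1) (huv : u * v ≠ 1) :
    e.turn u v = 1 ∨ e.turn u v = -1 := by
  rw [e.turn_of_ne hu hv huv]
  rcases e.angle_mul u v with h | h <;> rw [h]
  · left; ring
  · right; ring

/-- Taking signs loses nothing, so the cocycle identity may be checked on `turn`, a coboundary of
`saw`. -/
theorem sign_turn_cast (u v : G) : ((SignType.sign (e.turn u v) : ℤ) : ℝ) = e.turn u v := by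
  by_cases h : u = 1 ∨ v = 1 ∨ u * v = 1
  · simp [e.turn_eq_zero h]
  · push Not at h
    rcases e.turn_eq_one_or_neg_one h.1 h.2.1 h.2.2 with h | h <;> simp [h]

/-- The circular order induced from the circle. -/
noncomputable def toCircular : LeftCircularOrder G where
  toFun x y z := SignType.sign (e.turn (x⁻¹ * y) (y⁻¹ * z))
  eq_zero_iff' x y z := by
    have key : (x = y ∨ y = z ∨ x = z) ↔
        (x⁻¹ * y = 1 ∨ y⁻¹ * z = 1 ∨ (x⁻¹ * y) * (y⁻¹ * z) = 1) := by
      rw [inv_mul_eq_one, inv_mul_eq_one, mul_assoc, mul_inv_cancel_left, inv_mul_eq_one]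
    rw [sign_eq_zero_iff, key]
    refine ⟨fun h0 => ?_, e.turn_eq_zero⟩
    by_contra h
    push Not at h
    rcases e.turn_eq_one_or_neg_one h.1 h.2.1 h.2.2 with h | h <;> rw [h] at h0 <;> norm_num at h0
  cocycle' a b c d := by
    have h : ∀ x y z : G, e.turn (x⁻¹ * y) (y⁻¹ * z) =
        2 * (e.saw (x⁻¹ * z) - e.saw (x⁻¹ * y) - e.saw (y⁻¹ * z)) := fun x y z => by
      rw [turn, mul_assoc, mul_inv_cancel_left]
    have : (((SignType.sign (e.turn (b⁻¹ * c) (c⁻¹ * d)) : ℤ)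
        - (SignType.sign (e.turn (a⁻¹ * c) (c⁻¹ * d)) : ℤ)
        + (SignType.sign (e.turn (a⁻¹ * b) (b⁻¹ * d)) : ℤ)
        - (SignType.sign (e.turn (a⁻¹ * b) (b⁻¹ * c)) : ℤ) : ℤ) : ℝ) = 0 := by
      rw [Int.cast_sub, Int.cast_add, Int.cast_sub]
      simp only [sign_turn_cast]
      simp only [h]
      ring
    exact_mod_cast this
  left_inv' g x y z := by simp [mul_assoc]

theorem toCircular_toFun (x y z : G) :
    e.toCircular.toFun x y z = SignType.sign (e.turn (x⁻¹ * y) (y⁻¹ * z)) := rfl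

theorem toCircular_one_pow (g : G) (n : ℕ) :
    e.toCircular.toFun 1 (g ^ n) (g ^ (n + 1)) = SignType.sign (e.turn (g ^ n) g) := by
  rw [toCircular_toFun, pow_succ]; simp

/-! ### Rigidity, genuineness and faithfulness -/

/-- A circle embedding is determined by its circular order: the order determines the lifts of
the rotations by all powers of an element, hence the rotation number. -/
theorem angle_eq_of_toCircular_eq {e f : CircleEmbedding G}
    (h : e.toCircular = f.toCircular) (g : G) : e.angle g = f.angle g := by
  by_cases hg : g = 1
  · rw [hg, e.angle_one, f.angle_one]
  -- Both sides are minus the number of wraps made by the first `n` powers of `g`, which the order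
  -- detects.
  have key : ∀ n : ℕ, e.angle (g ^ n) - n * e.angle g = f.angle (g ^ n) - n * f.angle g := by
    intro n
    induction n with
    | zero => simp [angle_one]
    | succ n ih =>
      suffices e.angle (g ^ n * g) - e.angle (g ^ n) - e.angle g =
          f.angle (g ^ n * g) - f.angle (g ^ n) - f.angle g by
        rw [pow_succ]; push_cast; linarith
      by_cases h1 : g ^ n = 1
      · simp [h1, angle_one]
      by_cases h2 : g ^ n * g = 1
      -- Here `turn` vanishes and says nothing, but returning to 1 by a positive angle forces a
      -- wrap.
      · have aux : ∀ d : CircleEmbedding G,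
            d.angle (g ^ n * g) - d.angle (g ^ n) - d.angle g = -1 := by
          intro d
          have h3 := d.angle_mul (g ^ n) g
          have h4 := d.angle_nonneg (g ^ n)
          have h5 := (d.angle_nonneg g).lt_of_ne' (mt (d.angle_eq_zero g).1 hg)
          have h6 : d.angle (g ^ n * g) = 0 := by rw [h2, d.angle_one]
          rcases h3 with h3 | h3 <;> linarith
        rw [aux e, aux f]
      · have h3 : e.turn (g ^ n) g = f.turn (g ^ n) g := by
          rw [← e.sign_turn_cast, ← f.sign_turn_cast, ← e.toCircular_one_pow, h,
            f.toCircular_one_pow]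
        rw [e.turn_of_ne h1 hg h2, f.turn_of_ne h1 hg h2] at h3
        linarith
  by_contra hne
  -- By `key` the gap between the angles of `g ^ n` grows linearly in `n`, yet it stays below 1.
  obtain ⟨n, hn⟩ := exists_nat_gt (1 / |e.angle g - f.angle g|)
  rw [div_lt_iff₀ (abs_pos.2 (sub_ne_zero.2 hne))] at hn
  have h1 : (n : ℝ) * |e.angle g - f.angle g| = |e.angle (g ^ n) - f.angle (g ^ n)| := by
    calc (n : ℝ) * |e.angle g - f.angle g| = |n * (e.angle g - f.angle g)| := by
          rw [abs_mul, Nat.abs_cast]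
      _ = _ := congrArg _ (by linarith [key n])
  rw [h1, lt_abs] at hn
  have := e.angle_nonneg (g ^ n)
  have := e.angle_lt_one (g ^ n)
  have := f.angle_nonneg (g ^ n)
  have := f.angle_lt_one (g ^ n)
  rcases hn with hn | hn <;> linarith

/-- The circular order of a circle embedding of a nontrivial group is genuine. -/
theorem toCircular_mem_genuine [Nontrivial G] : e.toCircular ∈ LeftCircularOrder.genuine G := by
  rintro ⟨l, hl⟩
  obtain ⟨g, hg⟩ : ∃ g : G, l.lt 1 g := by
    obtain ⟨g, hg⟩ := exists_ne (1 : G)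
    rcases l.total' 1 g with h | h | h
    · exact ⟨g, h⟩
    · exact absurd h.symm hg
    · exact ⟨g⁻¹, by simpa using (l.left_inv' g⁻¹ g 1).2 h⟩
  have hstep : ∀ n : ℕ, l.lt (g ^ n) (g ^ (n + 1)) := fun n => by
    simpa [pow_succ] using (l.left_inv' (g ^ n) 1 g).2 hg
  have hpos : ∀ n : ℕ, l.lt 1 (g ^ (n + 1)) := fun n => by
    induction n with
    | zero => simpa using hg
    | succ n ih => exact l.trans' _ _ _ ih (hstep _)
  have hne : ∀ n : ℕ, g ^ (n + 1) ≠ 1 := fun n h => l.irrefl' 1 (by simpa [h] using hpos n)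
  have hg1 : g ≠ 1 := by simpa using hne 0
  -- The powers of a positive element increase, so they never wrap; their angles would then be
  -- unbounded.
  have key : ∀ n : ℕ, e.angle (g ^ n) = n * e.angle g := by
    intro n
    induction n with
    | zero => simp [angle_one]
    | succ n ih =>
      rcases n with _ | n
      · simp
      have h1 : l.cyc 1 (g ^ (n + 1)) (g ^ (n + 1 + 1)) = 1 :=
        if_pos (Or.inl ⟨hpos n, hstep _⟩)
      have h2 : e.turn (g ^ (n + 1)) g = 1 := by
        rw [← e.sign_turn_cast, ← e.toCircular_one_pow, ← hl]
        change ((l.cyc 1 (g ^ (n + 1)) (g ^ (n + 1 + 1)) : ℤ) : ℝ) = 1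
        simp [h1]
      rw [e.turn_of_ne (hne n) hg1 (by rw [← pow_succ]; exact hne _), ← pow_succ] at h2
      push_cast at ih ⊢
      linarith
  have hang := (e.angle_nonneg g).lt_of_ne' (mt (e.angle_eq_zero g).1 hg1)
  obtain ⟨n, hn⟩ := exists_nat_gt (1 / e.angle g)
  rw [div_lt_iff₀ hang, ← key] at hn
  exact absurd hn (e.angle_lt_one _).not_gt

/-- A group that embeds into the circle has a faithful action of its automorphism group on its
genuine circular orders. -/
theorem faithfulSMul_genuine (e : CircleEmbedding G) :
    FaithfulSMul (MulAut G) (LeftCircularOrder.genuine G) := by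
  refine ⟨fun {ρ σ} h => ?_⟩
  rcases subsingleton_or_nontrivial G with hG | hG
  · exact MulEquiv.ext fun x => Subsingleton.elim _ _
  have h1 : ρ • e.toCircular = σ • e.toCircular :=
    congrArg Subtype.val (h ⟨e.toCircular, e.toCircular_mem_genuine⟩)
  have hsmul : ∀ τ : MulAut G, τ • e.toCircular =
      (e.comap (τ⁻¹ : MulAut G).toMonoidHom (τ⁻¹ : MulAut G).injective).toCircular := by
    intro τ
    ext x y z : 4
    have hsaw : ∀ u : G, (e.comap (τ⁻¹ : MulAut G).toMonoidHom
        (τ⁻¹ : MulAut G).injective).saw u = e.saw (τ⁻¹ u) := fun u => by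
      by_cases hu : u = 1
      · simp [hu, saw_one]
      · rw [saw_of_ne _ hu, saw_of_ne _ (by simpa using hu)]; rfl
    rw [LeftCircularOrder.smul_toFun, toCircular_toFun, toCircular_toFun, turn, turn, hsaw, hsaw,
      hsaw]
    simp only [map_mul, map_inv]
  rw [hsmul, hsmul] at h1
  have hinj : ∀ u v : G, e.angle u = e.angle v → u = v := by
    intro u v huv
    have h2 := e.angle_mul v⁻¹ u
    have h3 := e.angle_mul v⁻¹ v
    rw [huv] at h2
    rw [inv_mul_cancel, e.angle_one] at h3
    have h4 := e.angle_nonneg (v⁻¹ * u)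
    have h5 := e.angle_lt_one (v⁻¹ * u)
    have h6 : v⁻¹ * u = 1 := (e.angle_eq_zero _).1 <| by
      rcases h2 with h2 | h2 <;> rcases h3 with h3 | h3 <;> linarith
    exact (inv_mul_eq_one.1 h6).symm
  have h2 : (ρ⁻¹ : MulAut G) = σ⁻¹ :=
    MulEquiv.ext fun x => hinj _ _ (angle_eq_of_toCircular_eq h1 x)
  exact inv_injective h2

end CircleEmbedding

namespace LeftCircularOrder

variable {G H : Type*} [Group G] [Group H]

/-- Restriction of a circular order along an injective homomorphism. -/
def comap (φ : LeftCircularOrder H) (f : G →* H) (hf : Function.Injective f) :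
    LeftCircularOrder G where
  toFun x y z := φ.toFun (f x) (f y) (f z)
  eq_zero_iff' x y z := by simp [φ.eq_zero_iff', hf.eq_iff]
  cocycle' _ _ _ _ := φ.cocycle' _ _ _ _
  left_inv' g x y z := by simp only [map_mul, φ.left_inv']

variable (φ : LeftCircularOrder G)

theorem cocycle_one (x y z : G) : (φ.toFun x y z : ℤ) =
    φ.toFun 1 y z - φ.toFun 1 x z + φ.toFun 1 x y := by
  linarith [φ.cocycle' 1 x y z]

theorem cyclic (x y z : G) : φ.toFun y z x = φ.toFun x y z := by
  have h1 := φ.cocycle' x y z x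
  have h2 := (φ.eq_zero_iff' x z x).2 (by simp)
  have h3 := (φ.eq_zero_iff' x y x).2 (by simp)
  rw [h2, h3] at h1
  generalize φ.toFun y z x = a at *
  generalize φ.toFun x y z = b at *
  revert a b; decide

theorem swap (x y : G) : (φ.toFun 1 x y : ℤ) = -φ.toFun 1 y x := by
  have h1 := φ.cocycle' 1 x y x
  have h2 := (φ.eq_zero_iff' x y x).2 (by simp)
  have h3 := (φ.eq_zero_iff' 1 x x).2 (by simp)
  rw [h2, h3] at h1
  simp at h1
  linarith

/-- Cutting the circle at 1 leaves a strict linear order on the other elements. -/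
theorem trans_one {x y z : G} (h1 : φ.toFun 1 x y = 1) (h2 : φ.toFun 1 y z = 1) :
    φ.toFun 1 x z = 1 := by
  have h := φ.cocycle_one x y z
  rw [h1, h2] at h
  generalize φ.toFun x y z = a at *
  generalize φ.toFun 1 x z = b at *
  revert a b; decide

theorem eq_one_or_of_ne {x y : G} (hx : x ≠ 1) (hy : y ≠ 1) (hxy : x ≠ y) :
    φ.toFun 1 x y = 1 ∨ φ.toFun 1 y x = 1 := by
  have h := φ.swap x y
  have h0 : φ.toFun 1 x y ≠ 0 := fun h0 => by
    rcases (φ.eq_zero_iff' _ _ _).1 h0 with h | h | h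
    exacts [hx h.symm, hxy h, hy h.symm]
  generalize φ.toFun 1 x y = a at *
  generalize φ.toFun 1 y x = b at *
  revert a b; decide

/-- A nonempty finite set of nonidentity elements has a first element in the order in which they
are met when starting from the identity. -/
theorem exists_first (s : Set G) (hs : s.Finite) (hne : s.Nonempty) (h1 : (1 : G) ∉ s) :
    ∃ g ∈ s, ∀ x ∈ s, x ≠ g → φ.toFun 1 g x = 1 := by
  let r : G → G → Prop := fun x y => φ.toFun 1 x y = 1
  have : IsTrans G r := ⟨fun _ _ _ => φ.trans_one⟩
  have : Std.Irrefl r := ⟨fun x (hx : φ.toFun 1 x x = 1) => by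
    rw [(φ.eq_zero_iff' 1 x x).2 (by simp)] at hx; exact absurd hx (by decide)⟩
  have : IsStrictOrder G r := {}
  obtain ⟨⟨g, hg⟩, -, hmin⟩ := (hs.wellFoundedOn (r := r)).has_min Set.univ
    ⟨⟨_, hne.some_mem⟩, trivial⟩
  refine ⟨g, hg, fun x hx hxg => ?_⟩
  exact (φ.eq_one_or_of_ne (ne_of_mem_of_not_mem hg h1) (ne_of_mem_of_not_mem hx h1)
    hxg.symm).resolve_right (hmin ⟨x, hx⟩ trivial)

/-- A finite circularly orderable group is cyclic. -/
theorem isCyclic_of_finite [Finite G] (φ : LeftCircularOrder G) : IsCyclic G := by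
  rcases subsingleton_or_nontrivial G with hG | hG
  · infer_instance
  -- The first element after 1 generates: if not, let `h` be the first element outside its powers.
  -- Then `h` precedes `h * g⁻¹` and `g` precedes `g * h⁻¹`; translating by `h⁻¹` and `g⁻¹` orders
  -- `g⁻¹`, `h⁻¹` in both ways.
  obtain ⟨g, hg, hmin⟩ := φ.exists_first {x | x ≠ 1} (Set.toFinite _) (exists_ne 1) (by simp)
  refine ⟨g, fun x => ?_⟩
  by_contra hx
  let s : Set G := {h | h ∉ Subgroup.zpowers g}
  have h1s : (1 : G) ∉ s := fun h => h (one_mem _)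
  obtain ⟨h, hh, hfirst⟩ := φ.exists_first s (Set.toFinite _) ⟨x, hx⟩ h1s
  have hgz := Subgroup.mem_zpowers g
  have hh1 : h⁻¹ ≠ 1 := inv_ne_one.2 (ne_of_mem_of_not_mem hh h1s)
  have hg1 : g⁻¹ ≠ 1 := inv_ne_one.2 hg
  have hhg : h ≠ g := fun e => hh (e ▸ hgz)
  have a1 : φ.toFun 1 h (h * g⁻¹) = 1 := by
    refine hfirst _ (fun hm => hh ?_) (by simpa using hg1)
    simpa using mul_mem hm hgz
  have a2 : φ.toFun 1 g⁻¹ h⁻¹ = 1 := by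
    rw [φ.cyclic h⁻¹, ← φ.left_inv' h, mul_inv_cancel, mul_one]
    exact a1
  have a3 : φ.toFun 1 h⁻¹ g⁻¹ = 1 := by
    have := hmin (g * h⁻¹) (fun e => hhg (mul_inv_eq_one.1 e).symm) (by simpa using hh1)
    rw [φ.cyclic g⁻¹, ← φ.left_inv' g, mul_inv_cancel, mul_one, ← φ.cyclic, ← φ.cyclic]
    rw [← φ.cyclic, ← φ.cyclic] at this
    exact this
  have a4 := φ.swap g⁻¹ h⁻¹
  rw [a2, a3] at a4
  exact absurd a4 (by decide)

end LeftCircularOrder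

/-- Finitely many reals whose nontrivial integral combinations are irrational. -/
theorem exists_forall_sum_eq_rat (n : ℕ) : ∃ v : Fin n → ℝ, ∀ (z : Fin n → ℤ) (q : ℚ),
    ∑ i, (z i : ℝ) * v i = q → z = 0 := by
  obtain ⟨w, hw⟩ : ∃ w : Fin (n + 1) → ℝ, LinearIndependent ℚ w := by
    have h : ((n + 1 : ℕ) : Cardinal) ≤ Module.rank ℚ ℝ := by
      rw [Real.rank_rat_real]
      exact (Cardinal.nat_lt_continuum _).le
    exact Module.le_rank_iff.1 h
  -- Dividing by `w 0` makes 1 a member of the independent family.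
  refine ⟨fun i => w i.succ / w 0, fun z q h => ?_⟩
  have h0 : w 0 ≠ 0 := hw.ne_zero 0
  rw [Fintype.linearIndependent_iff] at hw
  have key := hw (Fin.cons (-q) (fun i => (z i : ℚ))) (by
    rw [Fin.sum_univ_succ]
    simp only [Fin.cons_zero, Fin.cons_succ, Rat.smul_def]
    have : ∑ i, (z i : ℝ) * w i.succ = q * w 0 := by
      rw [← h, Finset.sum_mul]
      exact Finset.sum_congr rfl fun i _ => by field_simp
    push_cast
    rw [this]; ring)
  funext i
  simpa using key i.succ

/-- The product of a finitely generated free abelian group and a finite cyclic group embeds into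
the circle. -/
theorem nonempty_circleEmbedding_free_prod_zmod (n N : ℕ) [NeZero N] :
    Nonempty (CircleEmbedding (Multiplicative ((Fin n →₀ ℤ) × ZMod N))) := by
  obtain ⟨v, hv⟩ := exists_forall_sum_eq_rat n
  have hN : (N : ℝ) ≠ 0 := NeZero.ne _
  refine ⟨CircleEmbedding.ofLift
    (fun x => ∑ i, (x.toAdd.1 i : ℝ) * v i + (x.toAdd.2.val : ℝ) / N) (fun x y => ?_) ?_⟩
  · have h := Nat.mod_add_div (x.toAdd.2.val + y.toAdd.2.val) N
    rw [← ZMod.val_add] at h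
    have h' : (((x.toAdd.2 + y.toAdd.2).val : ℝ)) +
        N * ((x.toAdd.2.val + y.toAdd.2.val) / N : ℕ) = x.toAdd.2.val + y.toAdd.2.val := by
      exact_mod_cast h
    -- The integer defect is the carry in adding residues modulo `N`.
    refine ⟨-((x.toAdd.2.val + y.toAdd.2.val) / N : ℕ), ?_⟩
    simp only [toAdd_mul, Prod.fst_add, Prod.snd_add, Finsupp.add_apply, Int.cast_add, add_mul,
      Finset.sum_add_distrib]
    rw [← eq_sub_iff_add_eq] at h'
    rw [h', Int.cast_neg, Int.cast_natCast]
    field_simp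
    ring
  · rintro x ⟨k, hk⟩
    -- The torsion term is rational, so an integral total makes the irrational part rational.
    have h1 : ⇑x.toAdd.1 = 0 := hv _ (k - x.toAdd.2.val / N) (by push_cast; linarith)
    have h2 : x.toAdd.2 = 0 := by
      simp only [h1, Pi.zero_apply, Int.cast_zero, zero_mul, Finset.sum_const_zero, zero_add] at hk
      rw [div_eq_iff hN] at hk
      have h3 : (x.toAdd.2.val : ℤ) = k * N := by exact_mod_cast hk
      rw [← ZMod.val_eq_zero]
      refine Nat.eq_zero_of_dvd_of_lt ?_ (ZMod.val_lt x.toAdd.2)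
      exact Int.natCast_dvd_natCast.1 ⟨k, by rw [h3, mul_comm]⟩
    exact Multiplicative.toAdd.injective (Prod.ext (DFunLike.coe_injective h1) h2)

/-- A finitely generated circularly orderable abelian group embeds into the circle. -/
theorem LeftCircularOrder.nonempty_circleEmbedding {A : Type*} [CommGroup A] [Group.FG A]
    (φ : LeftCircularOrder A) : Nonempty (CircleEmbedding A) := by
  obtain ⟨n, ι, _, p, hp, e, ⟨f⟩⟩ := AddCommGroup.equiv_free_prod_directSum_zmod (Additive A)
  have (i : ι) : NeZero (p i ^ e i) := ⟨pow_ne_zero _ (hp i).ne_zero⟩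
  classical
  let T := DirectSum ι fun i => ZMod (p i ^ e i)
  have : Finite T :=
    Finite.of_equiv _ (DirectSum.addEquivProd fun i => ZMod (p i ^ e i)).symm.toEquiv
  let j : T →+ Additive A := f.symm.toAddMonoidHom.comp (AddMonoidHom.inr _ _)
  have hj : Function.Injective j := f.symm.injective.comp (Prod.mk_right_injective 0)
  have hcyc : IsCyclic (Multiplicative T) :=
    (φ.comap (AddMonoidHom.toMultiplicativeLeft j) hj).isCyclic_of_finite
  have hT : IsAddCyclic T := isCyclic_multiplicative_iff.1 hcyc
  have : NeZero (Nat.card T) := ⟨Nat.card_pos.ne'⟩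
  let F : Additive A ≃+ (Fin n →₀ ℤ) × ZMod (Nat.card T) :=
    f.trans ((AddEquiv.refl _).prodCongr (zmodAddCyclicAddEquiv hT).symm)
  obtain ⟨c⟩ := nonempty_circleEmbedding_free_prod_zmod n (Nat.card T)
  exact ⟨c.comap (AddMonoidHom.toMultiplicativeRight F.toAddMonoidHom) F.injective⟩

theorem corollary3p9 {A : Type*} [CommGroup A] [Group.FG A]
    (hA : Nonempty (LeftCircularOrder A)) :
    FaithfulSMul (MulAut A) (LeftCircularOrder.genuine A) := by
  obtain ⟨φ⟩ := hA
  obtain ⟨e⟩ := φ.nonempty_circleEmbedding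
  exact e.faithfulSMul_genuine
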